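/- Let $\mathbb{K}$ be a field of characteristic zero. **Permutations.** A permutation of size $n$ is a word containing each of the letters $1,\dots,n$ exactly once; $\mathfrak{S}_n$ is the set of these and $\mathfrak{S}=\bigcup_{n\ge0}\mathfrak{S}_n$. The (right) permutohedron order $\leq_{\mathrm P}$ on $\mathfrak{S}_n$ is generated by the covering relations $u\,ab\,v \lessdot u\,ba\,v$ with letters $a<b$. The algebra $\mathbf{FQSym}$ is the $\mathbb{K}$-vector space with basis $(\mathbf{F}_\sigma)_{\sigma\in\mathfrak{S}}$ and bilinear product $\mathbf{F}_\sigma\cdot\mathbf{F}_\nu=\sum_\pi \mathbf{F}_\pi$, where $\pi$ runs over the terms of the shuffle of the word $\sigma$ with the word obtained from $\nu$ by adding the size of $\sigma$ to every letter. **Twin binary trees.** The canopy of a binary tree is the sequence of orientations (left child or right child) of its leaves, read from left to right, omitting the first and the last leaf. A pair of twin binary trees is a pair $J=(T_L,T_R)$ of binary trees with the same number $n\ge 0$ of nodes whose canopies differ at every position; $\mathcal{TBT}_n$ is the set of these pairs. For binary trees $T_0,T_1$, let $T_0\diagup T_1$ be obtained by grafting the root of $T_0$ on the leftmost leaf of $T_1$,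 and $T_0\diagdown T_1$ by grafting the root of $T_1$ on the rightmost leaf of $T_0$. For $J_0=(T_L^0,T_R^0)\in\mathcal{TBT}_m$ and $J_1=(T_L^1,T_R^1)\in\mathcal{TBT}_n$, define the following elements of $\mathcal{TBT}_{m+n}$: $$J_0\diagup J_1:=(T_L^0\diagdown T_L^1,\;T_R^0\diagup T_R^1),\qquad J_0\diagdown J_1:=(T_L^0\diagup T_L^1,\;T_R^0\diagdown T_R^1).$$ **P-symbol and Baxter order.** For a permutation $\sigma$, let $\mathsf{P}(\sigma)=(T_L,T_R)$ be the pair of (unlabeled) shapes of the binary search trees obtained by inserting the letters of $\sigma$ as leaves, starting from the empty tree, from left to right for $T_L$ and from right to left for $T_R$. For $J,J'\in\mathcal{TBT}_n$, put $J\leq_{\mathrm B}J'$ if and only if there are $\sigma,\nu\in\mathfrak{S}_n$ with $\sigma\leq_{\mathrm P}\nu$, $\mathsf{P}(\sigma)=J$ and $\mathsf{P}(\nu)=J'$. **Statement.** For a pair of twin binary trees $J$, let $\mathbf{P}_J:=\sum_{\sigma\in\mathfrak{S},\,\mathsf{P}(\sigma)=J}\mathbf{F}_\sigma\in\mathbf{FQSym}$,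 and let $\mathbf{Baxter}$ be the linear span of all the $\mathbf{P}_J$. Then $\mathbf{Baxter}$ is closed under the product of $\mathbf{FQSym}$, and for all $m,n\ge 0$, $J_0\in\mathcal{TBT}_m$ and $J_1\in\mathcal{TBT}_n$, its product satisfies $$\mathbf{P}_{J_0}\cdot\mathbf{P}_{J_1}=\sum_{\substack{J\in\mathcal{TBT}_{m+n}\\ J_0\diagup J_1\,\leq_{\mathrm B}\,J\,\leq_{\mathrm B}\,J_0\diagdown J_1}}\mathbf{P}_J .$$ -/

import Mathlib

namespace BaxterAlg

/-! ### Words and permutations -/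

/-- Permutations of size `n`, seen as words of length `n` in which each of the letters
`1, ..., n` occurs exactly once. -/
def SymWord (n : ℕ) : Type := {w : List ℕ // w.Perm (List.range' 1 n)}

instance (n : ℕ) : DecidableEq (SymWord n) :=
  inferInstanceAs (DecidableEq {w : List ℕ // w.Perm (List.range' 1 n)})

instance (n : ℕ) : Fintype (SymWord n) :=
  Fintype.subtype (List.range' 1 n).permutations.toFinset (by simp)

/-- `SymCovBy σ ν`: in the right permutohedron order, `σ = u a b v` is covered by
`ν = u b a v`, where `a < b` are letters and `u`, `v` are words. -/
def SymCovBy {n : ℕ} (σ ν : SymWord n) : Prop :=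
  ∃ (u v : List ℕ) (a b : ℕ), a < b ∧ σ.1 = u ++ a :: b :: v ∧ ν.1 = u ++ b :: a :: v

/-- The (right) permutohedron order on permutations of size `n`. -/
def SymLE {n : ℕ} : SymWord n → SymWord n → Prop := Relation.ReflTransGen SymCovBy

/-- The shuffle product of two words, as the list (with multiplicities) of its terms. -/
def shuffle : List ℕ → List ℕ → List (List ℕ)
  | u, [] => [u]
  | [], b :: v => [b :: v]
  | a :: u, b :: v =>
      (shuffle u (b :: v)).map (a :: ·) ++ (shuffle (a :: u) v).map (b :: ·)
termination_by u v => u.length + v.length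

theorem perm_of_mem_shuffle (u v w : List ℕ) (h : w ∈ shuffle u v) : w.Perm (u ++ v) := by
  fun_induction shuffle u v generalizing w with
  | case1 u => simp_all
  | case2 b v => simp_all
  | case3 a u b v ih1 ih2 =>
    rw [List.mem_append, List.mem_map, List.mem_map] at h
    rcases h with ⟨x, hx, rfl⟩ | ⟨x, hx, rfl⟩
    · exact (ih1 x hx).cons a
    · exact ((ih2 x hx).cons b).trans List.perm_middle.symm

theorem perm_range_of_mem_shuffle {m n : ℕ} (σ : SymWord m) (ν : SymWord n) (w : List ℕ)
    (h : w ∈ shuffle σ.1 (ν.1.map (· + m))) : w.Perm (List.range' 1 (m + n)) := by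
  have h1 := perm_of_mem_shuffle _ _ _ h
  have h2 : (ν.1.map (· + m)).Perm (List.range' (1 + m) n) := by
    have h3 := ν.2.map (· + m)
    have h4 : (List.range' 1 n).map (· + m) = List.range' (1 + m) n := by
      have h5 : (fun x : ℕ => x + m) = (fun x => m + x) := by
        funext x
        omega
      rw [h5, List.map_add_range', Nat.add_comm]
    rwa [h4] at h3
  have h6 := h1.trans (σ.2.append h2)
  have h7 : List.range' 1 m ++ List.range' (1 + m) n = List.range' 1 (m + n) := by
    simp
  rwa [h7] at h6

/-- The shifted shuffle of `σ` and `ν`: the shuffle of `σ` with the word obtained from `ν` by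
adding the size of `σ` to every letter, as a list of permutations of size `m + n`. -/
def shiftedShuffle {m n : ℕ} (σ : SymWord m) (ν : SymWord n) : List (SymWord (m + n)) :=
  (shuffle σ.1 (ν.1.map (· + m))).attach.map
    fun w => ⟨w.1, perm_range_of_mem_shuffle σ ν w.1 w.2⟩

/-! ### Binary trees -/

/-- The orientations of the leaves of a binary tree from left to right: `true` (the letter `1`)
for a leaf that is a left child and `false` (the letter `0`) for a leaf that is a right child.
The second argument is the orientation given to the root when the tree is just a leaf. -/
def leafDirs : BinaryTree Unit → Bool → List Bool
  | .nil, o => [o]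
  | .node _ l r, _ => leafDirs l true ++ leafDirs r false

/-- The canopy: orientations of the leaves, except the first one and the last one. -/
def canopy (T : BinaryTree Unit) : List Bool := (leafDirs T true).tail.dropLast

/-- `T₀ ╱ T₁`: graft `T₀` from its root on the leftmost leaf of `T₁`. -/
def treeOver (T₀ : BinaryTree Unit) : BinaryTree Unit → BinaryTree Unit
  | .nil => T₀
  | .node _ l r => .node () (treeOver T₀ l) r

/-- `T₀ ╲ T₁`: graft `T₁` from its root on the rightmost leaf of `T₀`. -/
def treeUnder : BinaryTree Unit → BinaryTree Unit → BinaryTree Unit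
  | .nil, T₁ => T₁
  | .node _ l r, T₁ => .node () l (treeUnder r T₁)

theorem numNodes_treeOver (T₀ T₁ : BinaryTree Unit) :
    (treeOver T₀ T₁).numNodes = T₀.numNodes + T₁.numNodes := by
  induction T₁ with
  | nil => simp [treeOver]
  | node a l r ihl ihr =>
    simp only [treeOver, BinaryTree.numNodes, ihl]
    omega

theorem numNodes_treeUnder (T₀ T₁ : BinaryTree Unit) :
    (treeUnder T₀ T₁).numNodes = T₀.numNodes + T₁.numNodes := by
  induction T₀ with
  | nil => simp [treeUnder]
  | node a l r ihl ihr =>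
    simp only [treeUnder, BinaryTree.numNodes, ihr]
    omega

theorem treeOver_nil_left (T : BinaryTree Unit) : treeOver .nil T = T := by
  induction T with
  | nil => rfl
  | node a l r ihl ihr => simp [treeOver, ihl]

theorem treeUnder_nil_right (T : BinaryTree Unit) : treeUnder T .nil = T := by
  induction T with
  | nil => rfl
  | node a l r ihl ihr => simp [treeUnder, ihr]

theorem leafDirs_true (T : BinaryTree Unit) : ∃ c, leafDirs T true = true :: c := by
  induction T with
  | nil => exact ⟨[], rfl⟩
  | node a l r ihl ihr =>
    obtain ⟨c, hc⟩ := ihl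
    exact ⟨c ++ leafDirs r false, by simp [leafDirs, hc]⟩

theorem leafDirs_false (T : BinaryTree Unit) : ∃ c, leafDirs T false = c ++ [false] := by
  induction T with
  | nil => exact ⟨[], rfl⟩
  | node a l r ihl ihr =>
    obtain ⟨c, hc⟩ := ihr
    exact ⟨leafDirs l true ++ c, by simp [leafDirs, hc]⟩

theorem leafDirs_node (a : Unit) (l r : BinaryTree Unit) (o : Bool) :
    leafDirs (.node a l r) o = true :: (canopy (.node a l r) ++ [false]) := by
  obtain ⟨c, hc⟩ := leafDirs_true l
  obtain ⟨d, hd⟩ := leafDirs_false r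
  simp [canopy, leafDirs, hc, hd, ← List.append_assoc]

theorem leafDirs_treeOver (T₀ T₁ : BinaryTree Unit) :
    leafDirs (treeOver T₀ T₁) true = leafDirs T₀ true ++ (leafDirs T₁ true).tail := by
  induction T₁ with
  | nil => simp [treeOver, leafDirs]
  | node a l r ihl ihr =>
    obtain ⟨c, hc⟩ := leafDirs_true l
    simp [treeOver, leafDirs, ihl, hc]

theorem leafDirs_treeUnder (T₀ T₁ : BinaryTree Unit) :
    leafDirs (treeUnder T₀ T₁) false = (leafDirs T₀ false).dropLast ++ leafDirs T₁ false := by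
  induction T₀ with
  | nil => simp [treeUnder, leafDirs]
  | node a l r ihl ihr =>
    obtain ⟨c, hc⟩ := leafDirs_false r
    simp [treeUnder, leafDirs, ihr, hc, ← List.append_assoc]

theorem canopy_treeOver (a b : Unit) (l r l' r' : BinaryTree Unit) :
    canopy (treeOver (.node a l r) (.node b l' r')) =
      canopy (.node a l r) ++ false :: canopy (.node b l' r') := by
  rw [canopy, leafDirs_treeOver, leafDirs_node, leafDirs_node]
  simp only [List.tail_cons, List.cons_append, ← List.append_assoc, List.dropLast_concat]
  simp

theorem canopy_treeUnder (a b : Unit) (l r l' r' : BinaryTree Unit) :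
    canopy (treeUnder (.node a l r) (.node b l' r')) =
      canopy (.node a l r) ++ true :: canopy (.node b l' r') := by
  have h : leafDirs (treeUnder (.node a l r) (.node b l' r')) true =
      leafDirs (treeUnder (.node a l r) (.node b l' r')) false := rfl
  rw [canopy, h, leafDirs_treeUnder, leafDirs_node, leafDirs_node]
  rw [← List.cons_append, List.dropLast_concat, List.cons_append, List.tail_cons,
    ← List.cons_append, ← List.append_assoc, List.dropLast_concat]

theorem canopy_compl_graft (A B C D : BinaryTree Unit) (hAB : A.numNodes = B.numNodes)
    (hCD : C.numNodes = D.numNodes) (h₀ : List.Forall₂ (· ≠ ·) (canopy A) (canopy B))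
    (h₁ : List.Forall₂ (· ≠ ·) (canopy C) (canopy D)) :
    List.Forall₂ (· ≠ ·) (canopy (treeUnder A C)) (canopy (treeOver B D)) ∧
      List.Forall₂ (· ≠ ·) (canopy (treeOver A C)) (canopy (treeUnder B D)) := by
  rcases A with _ | ⟨a, Al, Ar⟩ <;> rcases B with _ | ⟨b, Bl, Br⟩
  · simpa [treeUnder, treeOver_nil_left] using h₁
  · simp at hAB
  · simp at hAB
  rcases C with _ | ⟨c, Cl, Cr⟩ <;> rcases D with _ | ⟨d, Dl, Dr⟩
  · simpa [treeOver, treeUnder_nil_right] using h₀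
  · simp at hCD
  · simp at hCD
  simp only [canopy_treeOver, canopy_treeUnder]
  exact ⟨List.rel_append h₀ (.cons (by decide) h₁), List.rel_append h₀ (.cons (by decide) h₁)⟩

/-! ### Pairs of twin binary trees -/

/-- Pairs of twin binary trees `(T_L, T_R)` with `n` nodes each: the canopies of the two trees
are complementary (they differ at every position). -/
@[ext]
structure TBT (n : ℕ) where
  left : BinaryTree Unit
  right : BinaryTree Unit
  numNodes_left : left.numNodes = n
  numNodes_right : right.numNodes = n
  canopy_compl : List.Forall₂ (· ≠ ·) (canopy left) (canopy right)

instance (n : ℕ) : Finite (TBT n) :=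
  Finite.of_injective
    (fun J : TBT n =>
      ((⟨J.left, BinaryTree.mem_treesOfNumNodesEq.2 J.numNodes_left⟩,
        ⟨J.right, BinaryTree.mem_treesOfNumNodesEq.2 J.numNodes_right⟩) :
        {t // t ∈ BinaryTree.treesOfNumNodesEq n} × {t // t ∈ BinaryTree.treesOfNumNodesEq n}))
    (fun J J' h => by
      simp only [Prod.mk.injEq, Subtype.mk.injEq] at h
      exact TBT.ext h.1 h.2)

noncomputable instance (n : ℕ) : Fintype (TBT n) := Fintype.ofFinite _

/-- `J₀ ╱ J₁ = (T_L⁰ ╲ T_L¹, T_R⁰ ╱ T_R¹)`. -/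
def TBT.over {m n : ℕ} (J₀ : TBT m) (J₁ : TBT n) : TBT (m + n) where
  left := treeUnder J₀.left J₁.left
  right := treeOver J₀.right J₁.right
  numNodes_left := by rw [numNodes_treeUnder, J₀.numNodes_left, J₁.numNodes_left]
  numNodes_right := by rw [numNodes_treeOver, J₀.numNodes_right, J₁.numNodes_right]
  canopy_compl := (canopy_compl_graft _ _ _ _ (J₀.numNodes_left.trans J₀.numNodes_right.symm)
    (J₁.numNodes_left.trans J₁.numNodes_right.symm) J₀.canopy_compl J₁.canopy_compl).1

/-- `J₀ ╲ J₁ = (T_L⁰ ╱ T_L¹, T_R⁰ ╲ T_R¹)`. -/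
def TBT.under {m n : ℕ} (J₀ : TBT m) (J₁ : TBT n) : TBT (m + n) where
  left := treeOver J₀.left J₁.left
  right := treeUnder J₀.right J₁.right
  numNodes_left := by rw [numNodes_treeOver, J₀.numNodes_left, J₁.numNodes_left]
  numNodes_right := by rw [numNodes_treeUnder, J₀.numNodes_right, J₁.numNodes_right]
  canopy_compl := (canopy_compl_graft _ _ _ _ (J₀.numNodes_left.trans J₀.numNodes_right.symm)
    (J₁.numNodes_left.trans J₁.numNodes_right.symm) J₀.canopy_compl J₁.canopy_compl).2

/-! ### The `P`-symbol -/

/-- Leaf insertion of a letter into a left binary search tree. -/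
def leafInsertLeft (a : ℕ) : BinaryTree ℕ → BinaryTree ℕ
  | .nil => .node a .nil .nil
  | .node b l r => if a < b then .node b (leafInsertLeft a l) r else .node b l (leafInsertLeft a r)

/-- Leaf insertion of a letter into a right binary search tree. -/
def leafInsertRight (a : ℕ) : BinaryTree ℕ → BinaryTree ℕ
  | .nil => .node a .nil .nil
  | .node b l r =>
      if a ≤ b then .node b (leafInsertRight a l) r else .node b l (leafInsertRight a r)

/-- The left binary search tree of the Baxter `P`-symbol of a word: leaf insertion of its
letters from left to right. -/
def pSymbolLeft (u : List ℕ) : BinaryTree ℕ := u.foldl (fun T a => leafInsertLeft a T) .nil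

/-- The right binary search tree of the Baxter `P`-symbol of a word: leaf insertion of its
letters from right to left. -/
def pSymbolRight (u : List ℕ) : BinaryTree ℕ := u.foldr leafInsertRight .nil

/-- The shape of a labeled binary tree. -/
def shape (T : BinaryTree ℕ) : BinaryTree Unit := T.map fun _ => ()

/-- `HasPSymbol σ J`: the Baxter `P`-symbol of the permutation `σ`, regarded as a pair of
unlabeled binary trees, is the pair of twin binary trees `J`. -/
def HasPSymbol {n : ℕ} (σ : SymWord n) (J : TBT n) : Prop :=
  shape (pSymbolLeft σ.1) = J.left ∧ shape (pSymbolRight σ.1) = J.right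

/-- The Baxter order on pairs of twin binary trees with `n` nodes. -/
instance (n : ℕ) : LE (TBT n) :=
  ⟨fun J₀ J₁ => ∃ σ ν : SymWord n, SymLE σ ν ∧ HasPSymbol σ J₀ ∧ HasPSymbol ν J₁⟩

/-! ### The algebras `FQSym` and `Baxter` -/

/-- The vector space `FQSym`, with basis all permutations (of all sizes). -/
def FQSym (K : Type*) [Field K] : Type _ := (Σ n : ℕ, SymWord n) →₀ K

section
variable (K : Type*) [Field K]

noncomputable instance : AddCommGroup (FQSym K) :=
  inferInstanceAs (AddCommGroup ((Σ n : ℕ, SymWord n) →₀ K))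

noncomputable instance : Module K (FQSym K) :=
  inferInstanceAs (Module K ((Σ n : ℕ, SymWord n) →₀ K))

/-- The fundamental basis of `FQSym`. -/
noncomputable def fundBasis : Module.Basis (Σ n : ℕ, SymWord n) K (FQSym K) :=
  Module.Basis.ofRepr (LinearEquiv.refl K ((Σ n : ℕ, SymWord n) →₀ K))

/-- The element `F_σ` of the fundamental basis of `FQSym`. -/
noncomputable def F {n : ℕ} (σ : SymWord n) : FQSym K := fundBasis K ⟨n, σ⟩

/-- The product of `FQSym`: the bilinear map such that `F_σ · F_ν` is the sum of the `F_π`, for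
`π` in the shifted shuffle of `σ` and `ν`. -/
noncomputable def mulBilin : FQSym K →ₗ[K] FQSym K →ₗ[K] FQSym K :=
  (fundBasis K).constr K fun σ => (fundBasis K).constr K fun ν =>
    ((shiftedShuffle σ.2 ν.2).map (F K)).sum

noncomputable instance : Mul (FQSym K) := ⟨fun x y => mulBilin K x y⟩

theorem F_mul_F {m n : ℕ} (σ : SymWord m) (ν : SymWord n) :
    F K σ * F K ν = ((shiftedShuffle σ ν).map (F K)).sum := by
  change mulBilin K (F K σ) (F K ν) = _
  simp [mulBilin, F]

open Classical in
/-- The element `P_J` of `FQSym`: the sum of the `F_σ` over all permutations `σ` whose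
`P`-symbol is `J`. (Such permutations have size `n` if the trees of `J` have `n` nodes.) -/
noncomputable def P {n : ℕ} (J : TBT n) : FQSym K :=
  ∑ σ : SymWord n with HasPSymbol σ J, F K σ

/-- The subspace `Baxter` of `FQSym` spanned by the `P_J`, for all pairs of twin binary trees. -/
noncomputable def Baxter : Submodule K (FQSym K) :=
  Submodule.span K (Set.range fun J : (Σ n : ℕ, TBT n) => P K J.2)

end

end BaxterAlg

namespace BaxterAlg

/-! ### Recursive structure of the binary search trees -/

/-! Both sides of the product formula are multiplicity-free sums of `F K π`, so the theorem compares
two sets of permutations. In a shifted shuffle, each letter's value tells which factor it came from.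
The left side therefore runs over the `π` whose restrictions to the letters `≤ m` and `> m` have
P-symbols `J₀` and `J₁` (`mem_shiftedShuffle_iff`). The right side runs over the `π` whose P-symbol
lies in the interval, and `mem_interval_iff` identifies the two conditions.

From restrictions to interval: if `u` and `v` are the low and high subwords of `π`, then `u ++ v ≤ π
≤ v ++ u` in the weak order, and concatenating words on separated alphabets grafts search trees
(`leftShape_append`, `leftShape_append_of_gt`).

From interval to restrictions: restriction preserves the weak order and is compatible with equality
of search trees (`pSymbolLeft_filter_congr`). Both ends of the interval restrict to the same pair of
trees, so the restrictions of `π` are squeezed between words with equal trees. Antisymmetry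
(`pSymbolLeft_eq_of_wordLE`) concludes; it rests on `RightReach`, a relation that determines the
tree and can only shrink along the weak order. Transitivity of the Baxter order is never needed.

The right tree is the left tree of the reversed word, and reversal inverts the weak order, so only
left trees are studied. -/

theorem foldl_leafInsertLeft_node (x : ℕ) (l r : BinaryTree ℕ) (w : List ℕ) :
    w.foldl (fun T a => leafInsertLeft a T) (.node x l r) =
      .node x ((w.filter (· < x)).foldl (fun T a => leafInsertLeft a T) l)
        ((w.filter (x ≤ ·)).foldl (fun T a => leafInsertLeft a T) r) := by
  induction w generalizing l r with
  | nil => rfl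
  | cons a w ih =>
    by_cases h : a < x
    · have h' : ¬ x ≤ a := by omega
      simp [leafInsertLeft, h, h', ih]
    · have h' : x ≤ a := by omega
      simp [leafInsertLeft, h, h', ih]

theorem pSymbolLeft_cons (x : ℕ) (w : List ℕ) :
    pSymbolLeft (x :: w) =
      .node x (pSymbolLeft (w.filter (· < x))) (pSymbolLeft (w.filter (x ≤ ·))) :=
  foldl_leafInsertLeft_node x .nil .nil w

theorem foldr_leafInsertRight_node (x : ℕ) (l r : BinaryTree ℕ) (w : List ℕ) :
    w.foldr leafInsertRight (.node x l r) =
      .node x ((w.filter (· ≤ x)).foldr leafInsertRight l)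
        ((w.filter (x < ·)).foldr leafInsertRight r) := by
  induction w with
  | nil => rfl
  | cons a w ih =>
    by_cases h : a ≤ x
    · have h' : ¬ x < a := by omega
      simp [leafInsertRight, h, h', ih]
    · have h' : x < a := by omega
      simp [leafInsertRight, h, h', ih]

theorem pSymbolRight_concat (x : ℕ) (w : List ℕ) :
    pSymbolRight (w ++ [x]) =
      .node x (pSymbolRight (w.filter (· ≤ x))) (pSymbolRight (w.filter (x < ·))) := by
  rw [pSymbolRight, List.foldr_append]
  exact foldr_leafInsertRight_node x .nil .nil w

/-- Induction on a word along the recursive structure of its left binary search tree. -/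
theorem word_induction {motive : List ℕ → Prop} (nil : motive [])
    (cons : ∀ x u, motive (u.filter (· < x)) → motive (u.filter (x ≤ ·)) → motive (x :: u))
    (w : List ℕ) : motive w := by
  induction h : w.length using Nat.strong_induction_on generalizing w with
  | _ k ih =>
    subst h
    cases w with
    | nil => exact nil
    | cons x u =>
      exact cons x u
        (ih _ (Nat.lt_succ_of_le (List.length_filter_le _ _)) _ rfl)
        (ih _ (Nat.lt_succ_of_le (List.length_filter_le _ _)) _ rfl)

/-- The two insertions differ only in how they break ties, which is harmless for distinct letters.
-/
theorem pSymbolRight_reverse (w : List ℕ) (hw : w.Nodup) :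
    pSymbolRight w.reverse = pSymbolLeft w := by
  induction w using word_induction with
  | nil => rfl
  | cons x u ih₁ ih₂ =>
    obtain ⟨hx, hu⟩ := List.nodup_cons.1 hw
    rw [List.reverse_cons, pSymbolRight_concat, pSymbolLeft_cons, ← ih₁ (hu.filter _),
      ← ih₂ (hu.filter _), List.filter_reverse, List.filter_reverse]
    have h₁ : u.filter (· ≤ x) = u.filter (· < x) :=
      List.filter_congr fun a ha => by
        have : a ≠ x := fun h => hx (h ▸ ha)
        simp; omega
    have h₂ : u.filter (x < ·) = u.filter (x ≤ ·) :=
      List.filter_congr fun a ha => by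
        have : a ≠ x := fun h => hx (h ▸ ha)
        simp; omega
    rw [h₁, h₂]

theorem pSymbolRight_eq (w : List ℕ) (hw : w.Nodup) :
    pSymbolRight w = pSymbolLeft w.reverse := by
  rw [← pSymbolRight_reverse _ (List.nodup_reverse.2 hw), List.reverse_reverse]

/-- The shape of the left binary search tree of a word. -/
def leftShape (w : List ℕ) : BinaryTree Unit := shape (pSymbolLeft w)

theorem leftShape_nil : leftShape [] = .nil := rfl

theorem leftShape_cons (x : ℕ) (w : List ℕ) :
    leftShape (x :: w) =
      .node () (leftShape (w.filter (· < x))) (leftShape (w.filter (x ≤ ·))) := by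
  simp [leftShape, pSymbolLeft_cons, shape, BinaryTree.map]

theorem numNodes_leftShape (w : List ℕ) : (leftShape w).numNodes = w.length := by
  induction w using word_induction with
  | nil => rfl
  | cons x u ih₁ ih₂ =>
    rw [leftShape_cons, BinaryTree.numNodes, ih₁, ih₂, List.length_cons,
      List.length_eq_length_filter_add (l := u) (fun a => decide (a < x))]
    have : u.filter (fun a => !decide (a < x)) = u.filter (x ≤ ·) :=
      List.filter_congr fun a _ => by rw [← decide_not]; simp
    rw [this]

/-! ### Words on intervals of letters -/

theorem perm_range'_iff (w : List ℕ) (s k : ℕ) :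
    w.Perm (List.range' s k) ↔ w.Nodup ∧ ∀ a, a ∈ w ↔ s ≤ a ∧ a < s + k := by
  constructor
  · intro h
    exact ⟨h.nodup_iff.2 List.nodup_range', fun a => by rw [h.mem_iff, List.mem_range'_1]⟩
  · rintro ⟨h₁, h₂⟩
    rw [List.perm_ext_iff_of_nodup h₁ List.nodup_range']
    intro a
    rw [h₂, List.mem_range'_1]

theorem filter_lt_perm_range' {w : List ℕ} {s k : ℕ} (h : w.Perm (List.range' s k)) (c : ℕ)
    (hc : c ≤ k) : (w.filter (· < s + c)).Perm (List.range' s c) := by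
  rw [perm_range'_iff] at h ⊢
  refine ⟨h.1.filter _, fun a => ?_⟩
  simp only [List.mem_filter, h.2, decide_eq_true_eq]
  omega

theorem filter_le_perm_range' {w : List ℕ} {s k : ℕ} (h : w.Perm (List.range' s k)) (c : ℕ)
    (hc : c ≤ k) : (w.filter (s + c ≤ ·)).Perm (List.range' (s + c) (k - c)) := by
  rw [perm_range'_iff] at h ⊢
  refine ⟨h.1.filter _, fun a => ?_⟩
  simp only [List.mem_filter, h.2, decide_eq_true_eq]
  omega

/-- The first letter of a word on an interval splits the other ones into two intervals. -/
theorem split_of_cons_perm_range' {x : ℕ} {u : List ℕ} {s k : ℕ}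
    (h : (x :: u).Perm (List.range' s k)) :
    ∃ i j, x = s + i ∧ k = i + j + 1 ∧ (u.filter (· < x)).Perm (List.range' s i) ∧
      (u.filter (x ≤ ·)).Perm (List.range' (x + 1) j) := by
  rw [perm_range'_iff] at h
  obtain ⟨hn, hm⟩ := h
  obtain ⟨hx, hu⟩ := List.nodup_cons.1 hn
  have h₀ := (hm x).1 (by simp)
  have h₁ : ∀ a, a ∈ u ↔ a ≠ x ∧ s ≤ a ∧ a < s + k := by
    intro a
    rw [← hm a, List.mem_cons]
    constructor
    · intro h
      exact ⟨fun e => hx (e ▸ h), .inr h⟩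
    · tauto
  refine ⟨x - s, s + k - 1 - x, by omega, by omega, ?_, ?_⟩ <;>
  · rw [perm_range'_iff]
    refine ⟨hu.filter _, fun a => ?_⟩
    simp only [List.mem_filter, h₁, decide_eq_true_eq]
    omega

theorem numNodes_leftShape_of_perm {w : List ℕ} {s k : ℕ} (h : w.Perm (List.range' s k)) :
    (leftShape w).numNodes = k := by
  rw [numNodes_leftShape, h.length_eq, List.length_range']

/-- The labels of a binary search tree on an interval are determined by its shape. -/
theorem pSymbolLeft_eq_of_leftShape_eq {w w' : List ℕ} {s k : ℕ}
    (h : w.Perm (List.range' s k)) (h' : w'.Perm (List.range' s k))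
    (e : leftShape w = leftShape w') : pSymbolLeft w = pSymbolLeft w' := by
  induction w using word_induction generalizing w' s k with
  | nil =>
    cases w' with
    | nil => rfl
    | cons x' u' => simp [leftShape_cons, leftShape_nil] at e
  | cons x u ih₁ ih₂ =>
    cases w' with
    | nil => simp [leftShape_cons, leftShape_nil] at e
    | cons x' u' =>
      rw [leftShape_cons, leftShape_cons, BinaryTree.node.injEq] at e
      obtain ⟨i, j, hx, hk, hl, hr⟩ := split_of_cons_perm_range' h
      obtain ⟨i', j', hx', hk', hl', hr'⟩ := split_of_cons_perm_range' h'
      -- The root label is `s` plus the size of the left subtree, so the shape fixes it.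
      have hi : i = i' := by
        rw [← numNodes_leftShape_of_perm hl, ← numNodes_leftShape_of_perm hl', e.2.1]
      have hj : j = j' := by omega
      obtain rfl : x = x' := by omega
      subst hi hj
      rw [pSymbolLeft_cons, pSymbolLeft_cons, ih₁ hl hl' e.2.1, ih₂ hr hr' e.2.2]

/-! ### The canopies of the two trees of a permutation -/

/-- Leaf number `a` lies in the gap between the letters `a` and `a + 1`, and hangs from the one
inserted later: it is a left child exactly when `a` precedes `a + 1`. The outermost leaves have no
such pair, so their values of `f` are imposed separately; `o` matters only for the empty tree. -/
theorem leafDirs_leftShape {w : List ℕ} {s k : ℕ} (h : w.Perm (List.range' (s + 1) k))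
    (f : ℕ → Bool) (o : Bool)
    (hf : ∀ a, s < a → a < s + k → (f a = true ↔ [a, a + 1].Sublist w))
    (h₀ : k = 0 → f s = o) (h₁ : k ≠ 0 → f s = true ∧ f (s + k) = false) :
    leafDirs (leftShape w) o = (List.range' s (k + 1)).map f := by
  induction w using word_induction generalizing s k o with
  | nil =>
    obtain rfl : k = 0 := by simpa using h.length_eq.symm
    simp [leftShape_nil, leafDirs, h₀]
  | cons x u ih₁ ih₂ =>
    have hx : x ∉ u := (List.nodup_cons.1 (((perm_range'_iff _ _ _).1 h).1)).1
    obtain ⟨i, j, rfl, rfl, hl, hr⟩ := split_of_cons_perm_range' h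
    obtain ⟨hs, hsk⟩ := h₁ (by omega)
    have hml := ((perm_range'_iff _ _ _).1 hl).2
    have hmr := ((perm_range'_iff _ _ _).1 hr).2
    -- With root `x = s + 1 + i`, the left subtree owns the leaves `s, ..., x - 1` and the right one
    -- the leaves from `x` on.
    rw [leftShape_cons, leafDirs, ih₁ hl true ?_ (fun _ => hs) ?_,
      ih₂ (s := s + 1 + i) hr false ?_ ?_ ?_, ← List.map_append]
    · have : s + 1 + i = s + (i + 1) := by omega
      rw [this, List.range'_append_1]
      congr 2
      omega
    · intro a ha ha'
      rw [hf a (by omega) (by omega)]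
      constructor
      · intro hs
        rcases List.cons_sublist_cons'.1 hs with h | h
        · have := h.filter (fun y => decide (s + 1 + i ≤ y))
          simpa [show s + 1 + i ≤ a by omega, show s + 1 + i ≤ a + 1 by omega] using this
        · omega
      · intro hs
        exact (hs.trans List.filter_sublist).cons _
    · rintro rfl
      rw [← hsk]; congr 1; omega
    -- The gap after the root: `x` comes first in the word, hence before `x + 1`.
    · intro hj
      refine ⟨(hf _ (by omega) (by omega)).2 ?_, by rw [← hsk]; congr 1; omega⟩
      have : s + 1 + i + 1 ∈ u := (List.mem_filter.1 ((hmr _).2 ⟨le_rfl, by omega⟩)).1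
      simpa using this
    · intro a ha ha'
      rw [hf a (by omega) (by omega)]
      constructor
      · intro hs
        have := hs.filter (fun y => decide (y < s + 1 + i))
        simpa [show a < s + 1 + i by omega, show a + 1 < s + 1 + i by omega] using this
      · intro hs
        exact (hs.trans List.filter_sublist).cons _
    -- The gap before the root: `x - 1` cannot precede the first letter `x`.
    · intro hi
      refine ⟨hs, ?_⟩
      rw [← Bool.not_eq_true, hf _ (by omega) (by omega)]
      intro h
      rcases List.cons_sublist_cons'.1 h with h | h
      · exact hx (by have := h.subset (a := s + 1 + i) (by simp; omega); exact this)
      · omega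

theorem sublist_pair_reverse_iff {w : List ℕ} (hw : w.Nodup) {a b : ℕ} (ha : a ∈ w)
    (hb : b ∈ w) (hab : a ≠ b) : [a, b].Sublist w.reverse ↔ ¬ [a, b].Sublist w := by
  have key : [a, b].Sublist w.reverse ↔ [b, a].Sublist w := by
    rw [← List.reverse_sublist]; simp
  rw [key]
  induction w with
  | nil => simp at ha
  | cons x w ih =>
    obtain ⟨hx, hw⟩ := List.nodup_cons.1 hw
    simp only [List.cons_sublist_cons', List.singleton_sublist]
    by_cases h1 : a = x
    · subst h1
      have h3 : ¬ [b, a].Sublist w := fun h => hx (h.subset (by simp))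
      have h4 : b ∈ w := by simpa [Ne.symm hab] using hb
      simp [h3, h4, Ne.symm hab]
    · have ha' : a ∈ w := by simpa [h1] using ha
      by_cases h2 : b = x
      · subst h2
        have h3 : ¬ [a, b].Sublist w := fun h => hx (h.subset (by simp))
        simp [h3, ha', hab]
      · have hb' : b ∈ w := by simpa [h2] using hb
        simp only [h1, h2, false_and, or_false]
        exact ih hw ha' hb' (by rw [← List.reverse_sublist]; simp)

theorem canopy_leftShape {w : List ℕ} {n : ℕ} (h : w.Perm (List.range' 1 n)) :
    canopy (leftShape w) =
      (List.range' 1 (n - 1)).map fun a => decide ([a, a + 1].Sublist w) := by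
  rcases n with _ | n
  · have : w = [] := by simpa using h
    subst this
    rfl
  have hd := leafDirs_leftShape (s := 0) h
    -- The indices `0` and `n + 1` are the two outer leaves, forced to be left and right; the canopy
    -- drops them.
    (fun a => decide (a = 0 ∨ a ≠ n + 1 ∧ [a, a + 1].Sublist w)) true
    (by intro a h1 h2
        have : a ≠ 0 := by omega
        have : a ≠ n + 1 := by omega
        simp [*])
    (by simp) (by simp)
  rw [canopy, hd, List.range'_succ, List.map_cons, List.tail_cons, List.range'_1_concat,
    List.map_append, List.map_singleton, List.dropLast_concat]
  refine List.map_congr_left fun a ha => ?_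
  rw [List.mem_range'_1] at ha
  have : a ≠ 0 := by omega
  have : a ≠ n + 1 := by omega
  simp [*]

/-- Reversal exchanges the order of `a` and `a + 1`, which flips every inner leaf. This makes
`pSymbol` land in `TBT n`. -/
theorem canopy_leftShape_reverse {w : List ℕ} {n : ℕ} (h : w.Perm (List.range' 1 n)) :
    List.Forall₂ (· ≠ ·) (canopy (leftShape w)) (canopy (leftShape w.reverse)) := by
  rw [canopy_leftShape h, canopy_leftShape ((List.reverse_perm w).trans h),
    List.forall₂_map_left_iff, List.forall₂_map_right_iff, List.forall₂_same]
  intro a ha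
  rw [List.mem_range'_1] at ha
  obtain ⟨hw, hm⟩ := (perm_range'_iff _ _ _).1 h
  have := sublist_pair_reverse_iff hw ((hm a).2 (by omega)) ((hm (a + 1)).2 (by omega))
    (by omega)
  simp [this]

/-- The pair of twin binary trees of a permutation. -/
def pSymbol {n : ℕ} (σ : SymWord n) : TBT n where
  left := leftShape σ.1
  right := leftShape σ.1.reverse
  numNodes_left := numNodes_leftShape_of_perm σ.2
  numNodes_right := numNodes_leftShape_of_perm ((List.reverse_perm _).trans σ.2)
  canopy_compl := canopy_leftShape_reverse σ.2

theorem hasPSymbol_iff {n : ℕ} (σ : SymWord n) (J : TBT n) : HasPSymbol σ J ↔ pSymbol σ = J := by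
  have hn : σ.1.Nodup := ((perm_range'_iff _ _ _).1 σ.2).1
  rw [HasPSymbol, pSymbolRight_eq _ hn, TBT.ext_iff]
  rfl

/-! ### Restriction of words to intervals and grafting -/

/-- Letters larger than all of `u` travel down the right spine, so `v` builds its own tree at the
rightmost leaf. -/
theorem leftShape_append {u v : List ℕ} (h : ∀ a ∈ u, ∀ b ∈ v, a < b) :
    leftShape (u ++ v) = treeUnder (leftShape u) (leftShape v) := by
  induction u using word_induction with
  | nil => rfl
  | cons x u ih₁ ih₂ =>
    have h₁ : v.filter (· < x) = [] := by
      rw [List.filter_eq_nil_iff]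
      intro b hb
      have := h x (by simp) b hb
      simp; omega
    have h₂ : v.filter (x ≤ ·) = v := by
      rw [List.filter_eq_self]
      intro b hb
      have := h x (by simp) b hb
      simp; omega
    rw [List.cons_append, leftShape_cons, leftShape_cons, treeUnder, List.filter_append,
      List.filter_append, h₁, h₂, List.append_nil,
      ih₂ fun a ha => h a (List.mem_cons_of_mem _ (List.mem_of_mem_filter ha))]

theorem leftShape_append_of_gt {u v : List ℕ} (h : ∀ a ∈ u, ∀ b ∈ v, b < a) :
    leftShape (u ++ v) = treeOver (leftShape v) (leftShape u) := by
  induction u using word_induction with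
  | nil => rfl
  | cons x u ih₁ ih₂ =>
    have h₁ : v.filter (x ≤ ·) = [] := by
      rw [List.filter_eq_nil_iff]
      intro b hb
      have := h x (by simp) b hb
      simp; omega
    have h₂ : v.filter (· < x) = v := by
      rw [List.filter_eq_self]
      intro b hb
      have := h x (by simp) b hb
      simp; omega
    rw [List.cons_append, leftShape_cons, leftShape_cons, treeOver, List.filter_append,
      List.filter_append, h₁, h₂, List.append_nil,
      ih₁ fun a ha => h a (List.mem_cons_of_mem _ (List.mem_of_mem_filter ha))]

theorem leftShape_map_add (w : List ℕ) (m : ℕ) : leftShape (w.map (· + m)) = leftShape w := by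
  induction w using word_induction with
  | nil => rfl
  | cons x u ih₁ ih₂ =>
    rw [List.map_cons, leftShape_cons, leftShape_cons, ← ih₁, ← ih₂, List.filter_map,
      List.filter_map]
    simp [Function.comp_def]

theorem filter_lt_eq_self {w : List ℕ} {s k c : ℕ} (h : w.Perm (List.range' s k))
    (hc : s + k ≤ c) : w.filter (· < c) = w := by
  rw [List.filter_eq_self]
  intro a ha
  have := (((perm_range'_iff _ _ _).1 h).2 a).1 ha
  simp; omega

theorem filter_le_eq_self {w : List ℕ} {s k c : ℕ} (h : w.Perm (List.range' s k))
    (hc : c ≤ s) : w.filter (c ≤ ·) = w := by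
  rw [List.filter_eq_self]
  intro a ha
  have := (((perm_range'_iff _ _ _).1 h).2 a).1 ha
  simp; omega

theorem filter_lt_eq_nil {w : List ℕ} {s k c : ℕ} (h : w.Perm (List.range' s k))
    (hc : c ≤ s) : w.filter (· < c) = [] := by
  rw [List.filter_eq_nil_iff]
  intro a ha
  have := (((perm_range'_iff _ _ _).1 h).2 a).1 ha
  simp; omega

theorem filter_le_eq_nil {w : List ℕ} {s k c : ℕ} (h : w.Perm (List.range' s k))
    (hc : s + k ≤ c) : w.filter (c ≤ ·) = [] := by
  rw [List.filter_eq_nil_iff]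
  intro a ha
  have := (((perm_range'_iff _ _ _).1 h).2 a).1 ha
  simp; omega

theorem filter_lt_filter_lt {x c : ℕ} (h : c ≤ x) (u : List ℕ) :
    (u.filter (· < x)).filter (· < c) = u.filter (· < c) := by
  rw [List.filter_filter]
  refine List.filter_congr fun a _ => ?_
  rw [← Bool.decide_and]
  exact decide_eq_decide.2 (by omega)

theorem filter_lt_filter_lt' {x c : ℕ} (h : x ≤ c) (u : List ℕ) :
    (u.filter (· < x)).filter (· < c) = u.filter (· < x) := by
  rw [List.filter_filter]
  refine List.filter_congr fun a _ => ?_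
  rw [← Bool.decide_and]
  exact decide_eq_decide.2 (by omega)

theorem filter_le_filter_le {x c : ℕ} (h : x ≤ c) (u : List ℕ) :
    (u.filter (x ≤ ·)).filter (c ≤ ·) = u.filter (c ≤ ·) := by
  rw [List.filter_filter]
  refine List.filter_congr fun a _ => ?_
  rw [← Bool.decide_and]
  exact decide_eq_decide.2 (by omega)

theorem filter_le_filter_le' {x c : ℕ} (h : c ≤ x) (u : List ℕ) :
    (u.filter (x ≤ ·)).filter (c ≤ ·) = u.filter (x ≤ ·) := by
  rw [List.filter_filter]
  refine List.filter_congr fun a _ => ?_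
  rw [← Bool.decide_and]
  exact decide_eq_decide.2 (by omega)

/-- Cutting a search tree at `c` only cuts one subtree of the root `x`: if `x < c`, the low part
keeps `x` and the cut continues in the right subtree; otherwise it continues in the left one. This
lemma and the next ones record the cases. -/
theorem pSymbolLeft_cons_filter_lt {x c : ℕ} (h : x < c) (u : List ℕ) :
    pSymbolLeft ((x :: u).filter (· < c)) =
      .node x (pSymbolLeft (u.filter (· < x)))
        (pSymbolLeft ((u.filter (x ≤ ·)).filter (· < c))) := by
  rw [List.filter_cons_of_pos (by simpa using h), pSymbolLeft_cons,
    List.filter_comm (x ≤ ·), List.filter_comm (· < x), filter_lt_filter_lt' h.le]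

theorem cons_filter_lt {x c : ℕ} (h : c ≤ x) (u : List ℕ) :
    (x :: u).filter (· < c) = (u.filter (· < x)).filter (· < c) := by
  rw [List.filter_cons_of_neg (by simpa using h), filter_lt_filter_lt h]

theorem pSymbolLeft_cons_filter_le {x c : ℕ} (h : c ≤ x) (u : List ℕ) :
    pSymbolLeft ((x :: u).filter (c ≤ ·)) =
      .node x (pSymbolLeft ((u.filter (· < x)).filter (c ≤ ·)))
        (pSymbolLeft (u.filter (x ≤ ·))) := by
  rw [List.filter_cons_of_pos (by simpa using h), pSymbolLeft_cons,
    List.filter_comm (x ≤ ·), List.filter_comm (· < x), filter_le_filter_le' h]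

theorem cons_filter_le {x c : ℕ} (h : x < c) (u : List ℕ) :
    (x :: u).filter (c ≤ ·) = (u.filter (x ≤ ·)).filter (c ≤ ·) := by
  rw [List.filter_cons_of_neg (by simpa using h), filter_le_filter_le h.le]

theorem leftShape_cons_filter_lt {x c : ℕ} (h : x < c) (u : List ℕ) :
    leftShape ((x :: u).filter (· < c)) =
      .node () (leftShape (u.filter (· < x)))
        (leftShape ((u.filter (x ≤ ·)).filter (· < c))) := by
  rw [leftShape, pSymbolLeft_cons_filter_lt h]
  rfl

theorem leftShape_cons_filter_le {x c : ℕ} (h : c ≤ x) (u : List ℕ) :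
    leftShape ((x :: u).filter (c ≤ ·)) =
      .node () (leftShape ((u.filter (· < x)).filter (c ≤ ·)))
        (leftShape (u.filter (x ≤ ·))) := by
  rw [leftShape, pSymbolLeft_cons_filter_le h]
  rfl

/-- Labels increase in infix order, so the nodes of `A` carry the smallest letters and cutting at
`c` undoes the grafting. The induction descends the right spine of `A`. -/
theorem leftShape_filter_of_eq_treeUnder {w : List ℕ} {s k c : ℕ}
    (h : w.Perm (List.range' s k)) {A C : BinaryTree Unit} (hc : c = s + A.numNodes)
    (e : leftShape w = treeUnder A C) :
    leftShape (w.filter (· < c)) = A ∧ leftShape (w.filter (c ≤ ·)) = C := by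
  induction A generalizing w s k with
  | nil =>
    obtain rfl : c = s := by simpa using hc
    rw [filter_lt_eq_nil h le_rfl, filter_le_eq_self h le_rfl]
    exact ⟨rfl, e⟩
  | node a l r _ ih =>
    cases w with
    | nil => simp [leftShape_nil, treeUnder] at e
    | cons x u =>
      rw [leftShape_cons, treeUnder, BinaryTree.node.injEq] at e
      obtain ⟨i, j, hx, hk, hl, hr⟩ := split_of_cons_perm_range' h
      obtain ⟨-, el, er⟩ := e
      have hi : i = l.numNodes := by rw [← el, numNodes_leftShape_of_perm hl]
      simp only [BinaryTree.numNodes] at hc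
      obtain ⟨e₁, e₂⟩ := ih hr (by omega) er
      rw [leftShape_cons_filter_lt (by omega), cons_filter_le (by omega), e₁, e₂, el]
      exact ⟨rfl, rfl⟩

theorem leftShape_filter_of_eq_treeOver {w : List ℕ} {s k c : ℕ}
    (h : w.Perm (List.range' s k)) {A C : BinaryTree Unit} (hc : c = s + A.numNodes)
    (e : leftShape w = treeOver A C) :
    leftShape (w.filter (· < c)) = A ∧ leftShape (w.filter (c ≤ ·)) = C := by
  induction C generalizing w s k with
  | nil =>
    have hk : A.numNodes = k := by
      rw [← numNodes_leftShape_of_perm h, e, treeOver]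
    rw [filter_lt_eq_self h (by omega), filter_le_eq_nil h (by omega)]
    exact ⟨e, rfl⟩
  | node a l r ih _ =>
    cases w with
    | nil => simp [leftShape_nil, treeOver] at e
    | cons x u =>
      rw [leftShape_cons, treeOver, BinaryTree.node.injEq] at e
      obtain ⟨i, j, hx, hk, hl, hr⟩ := split_of_cons_perm_range' h
      obtain ⟨-, el, er⟩ := e
      have hi : i = A.numNodes + l.numNodes := by
        rw [← numNodes_treeOver, ← el, numNodes_leftShape_of_perm hl]
      obtain ⟨e₁, e₂⟩ := ih hl hc el
      rw [leftShape_cons_filter_le (by omega), cons_filter_lt (by omega), e₁, e₂, er]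
      exact ⟨rfl, rfl⟩

/-- The search tree of a restriction is obtained by cutting the search tree of the word, so it does
not depend on the chosen representative. -/
theorem pSymbolLeft_filter_congr {w w' : List ℕ} (e : pSymbolLeft w = pSymbolLeft w') (c : ℕ) :
    pSymbolLeft (w.filter (· < c)) = pSymbolLeft (w'.filter (· < c)) ∧
      pSymbolLeft (w.filter (c ≤ ·)) = pSymbolLeft (w'.filter (c ≤ ·)) := by
  induction w using word_induction generalizing w' with
  | nil =>
    cases w' with
    | nil => exact ⟨rfl, rfl⟩
    | cons x' u' => rw [pSymbolLeft_cons] at e; cases e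
  | cons x u ih₁ ih₂ =>
    cases w' with
    | nil => rw [pSymbolLeft_cons] at e; cases e
    | cons x' u' =>
      rw [pSymbolLeft_cons, pSymbolLeft_cons, BinaryTree.node.injEq] at e
      obtain ⟨rfl, el, er⟩ := e
      rcases lt_or_ge x c with h | h
      · rw [pSymbolLeft_cons_filter_lt h, pSymbolLeft_cons_filter_lt h, cons_filter_le h,
          cons_filter_le h, (ih₂ er).1, (ih₂ er).2, el]
        exact ⟨rfl, rfl⟩
      · rw [pSymbolLeft_cons_filter_le h, pSymbolLeft_cons_filter_le h, cons_filter_lt h,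
          cons_filter_lt h, (ih₁ el).1, (ih₁ el).2, er]
        exact ⟨rfl, rfl⟩

/-! ### A monotone invariant of the left binary search tree -/

/-- In the left binary search tree of `w`, the node `b` lies in the right subtree of `a`. -/
def RightReach (w : List ℕ) (a b : ℕ) : Prop :=
  a ∈ w ∧ b ∈ w ∧ a < b ∧ ∀ c ∈ w, a < c → c ≤ b → [a, c].Sublist w

theorem pair_sublist_filter_iff (w : List ℕ) (p : ℕ → Bool) (a b : ℕ) :
    [a, b].Sublist (w.filter p) ↔ [a, b].Sublist w ∧ p a ∧ p b := by
  constructor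
  · intro h
    exact ⟨h.trans List.filter_sublist, (List.mem_filter.1 (h.subset (by simp))).2,
      (List.mem_filter.1 (h.subset (by simp))).2⟩
  · rintro ⟨h, ha, hb⟩
    simpa [ha, hb] using h.filter p

/-- `RightReach` only inspects letters between `a` and `b`; when `b < x`, neither the head nor the
discarded letters are among them. -/
theorem rightReach_filter_lt {x : ℕ} {u : List ℕ} {a b : ℕ} :
    RightReach (u.filter (· < x)) a b ↔ RightReach (x :: u) a b ∧ b < x := by
  simp only [RightReach, pair_sublist_filter_iff, List.mem_filter, List.mem_cons,
    decide_eq_true_eq]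
  constructor
  · rintro ⟨⟨ha, hax⟩, ⟨hb, hbx⟩, hab, h⟩
    refine ⟨⟨.inr ha, .inr hb, hab, fun c hc hac hcb => ?_⟩, hbx⟩
    rcases hc with rfl | hc
    · omega
    · exact (h c ⟨hc, by omega⟩ hac hcb).1.cons _
  · rintro ⟨⟨ha, hb, hab, h⟩, hbx⟩
    refine ⟨⟨ha.resolve_left (by omega), by omega⟩, ⟨hb.resolve_left (by omega), hbx⟩, hab,
      fun c hc hac hcb => ⟨?_, by omega, hc.2⟩⟩
    rcases List.cons_sublist_cons'.1 (h c (.inr hc.1) hac hcb) with h | h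
    · exact h
    · omega

theorem rightReach_filter_le {x : ℕ} {u : List ℕ} (hx : x ∉ u) {a b : ℕ} :
    RightReach (u.filter (x ≤ ·)) a b ↔ RightReach (x :: u) a b ∧ x < a := by
  simp only [RightReach, pair_sublist_filter_iff, List.mem_filter, List.mem_cons,
    decide_eq_true_eq]
  constructor
  · rintro ⟨⟨ha, hax⟩, ⟨hb, hbx⟩, hab, h⟩
    have : a ≠ x := fun e => hx (e ▸ ha)
    refine ⟨⟨.inr ha, .inr hb, hab, fun c hc hac hcb => ?_⟩, by omega⟩
    rcases hc with rfl | hc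
    · omega
    · exact (h c ⟨hc, by omega⟩ hac hcb).1.cons _
  · rintro ⟨⟨ha, hb, hab, h⟩, hbx⟩
    refine ⟨⟨ha.resolve_left (by omega), by omega⟩, ⟨hb.resolve_left (by omega), by omega⟩, hab,
      fun c hc hac hcb => ⟨?_, by omega, hc.2⟩⟩
    rcases List.cons_sublist_cons'.1 (h c (.inr hc.1) hac hcb) with h | h
    · exact h
    · omega

theorem rightReach_head {x b : ℕ} {u : List ℕ} :
    RightReach (x :: u) x b ↔ b ∈ u ∧ x < b := by
  constructor
  · rintro ⟨-, hb, hab, -⟩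
    exact ⟨(List.mem_cons.1 hb).resolve_left (by omega), hab⟩
  · rintro ⟨hb, hab⟩
    refine ⟨by simp, by simp [hb], hab, fun c hc hac _ => ?_⟩
    have : c ∈ u := (List.mem_cons.1 hc).resolve_left (by omega)
    simpa using this

theorem not_rightReach_of_lt_head {x a b : ℕ} {u : List ℕ} (hx : x ∉ u) (ha : a < x)
    (hb : x ≤ b) : ¬ RightReach (x :: u) a b := by
  rintro ⟨-, -, -, h⟩
  rcases List.cons_sublist_cons'.1 (h x (by simp) ha hb) with h | h
  · exact hx (h.subset (by simp))
  · omega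

/-- No pair straddles the root: if `a < x ≤ b`, the first letter `x` lies in the tested range but
precedes `a`. So the relation follows the recursion of the tree. -/
theorem rightReach_cons_iff {x a b : ℕ} {u : List ℕ} (hx : x ∉ u) :
    RightReach (x :: u) a b ↔ (a = x ∧ b ∈ u ∧ x < b) ∨ RightReach (u.filter (· < x)) a b ∨
      RightReach (u.filter (x ≤ ·)) a b := by
  rw [rightReach_filter_lt, rightReach_filter_le hx]
  rcases lt_trichotomy a x with h | rfl | h
  · by_cases hb : x ≤ b
    · have := not_rightReach_of_lt_head hx h hb
      simp only [this]
      simp; omega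
    · have h1 : b < x := by omega
      have h2 : ¬ x < a := by omega
      have h3 : a ≠ x := by omega
      simp [h1, h2, h3]
  · rw [rightReach_head]
    simp only [true_and, lt_irrefl, and_false, or_false]
    constructor
    · exact .inl
    · rintro (h | h)
      · exact h
      · exact h.1
  · have h3 : a ≠ x := by omega
    simp only [h3, h, false_and, false_or, and_true]
    tauto

theorem mem_iff_of_pSymbolLeft_eq {w w' : List ℕ} (e : pSymbolLeft w = pSymbolLeft w') (a : ℕ) :
    a ∈ w ↔ a ∈ w' := by
  induction w using word_induction generalizing w' with
  | nil =>
    cases w' with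
    | nil => rfl
    | cons x' u' => rw [pSymbolLeft_cons] at e; cases e
  | cons x u ih₁ ih₂ =>
    cases w' with
    | nil => rw [pSymbolLeft_cons] at e; cases e
    | cons x' u' =>
      rw [pSymbolLeft_cons, pSymbolLeft_cons, BinaryTree.node.injEq] at e
      obtain ⟨rfl, el, er⟩ := e
      have h₁ := ih₁ el
      have h₂ := ih₂ er
      simp only [List.mem_filter, decide_eq_true_eq] at h₁ h₂
      rw [List.mem_cons, List.mem_cons]
      rcases lt_or_ge a x with h | h
      · simp only [h, and_true] at h₁
        rw [h₁]
      · simp only [h, and_true] at h₂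
        rw [h₂]

theorem rightReach_iff_of_pSymbolLeft_eq {w w' : List ℕ} (hw : w.Nodup) (hw' : w'.Nodup)
    (e : pSymbolLeft w = pSymbolLeft w') (a b : ℕ) : RightReach w a b ↔ RightReach w' a b := by
  induction w using word_induction generalizing w' with
  | nil =>
    cases w' with
    | nil => rfl
    | cons x' u' => rw [pSymbolLeft_cons] at e; cases e
  | cons x u ih₁ ih₂ =>
    cases w' with
    | nil => rw [pSymbolLeft_cons] at e; cases e
    | cons x' u' =>
      have hm := mem_iff_of_pSymbolLeft_eq e b
      rw [pSymbolLeft_cons, pSymbolLeft_cons, BinaryTree.node.injEq] at e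
      obtain ⟨rfl, el, er⟩ := e
      obtain ⟨hx, hu⟩ := List.nodup_cons.1 hw
      obtain ⟨hx', hu'⟩ := List.nodup_cons.1 hw'
      rw [rightReach_cons_iff hx, rightReach_cons_iff hx',
        ih₁ (hu.filter _) (hu'.filter _) el, ih₂ (hu.filter _) (hu'.filter _) er]
      have : b ∈ u ∧ x < b ↔ b ∈ u' ∧ x < b := by
        refine and_congr_left fun h => ?_
        have hb : b ≠ x := by omega
        simpa [hb] using hm
      rw [this]

theorem pSymbolLeft_eq_of_rightReach_iff {w w' : List ℕ} (hw : w.Nodup) (hw' : w'.Nodup)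
    (hm : ∀ a, a ∈ w ↔ a ∈ w') (h : ∀ a b, RightReach w a b ↔ RightReach w' a b) :
    pSymbolLeft w = pSymbolLeft w' := by
  induction w using word_induction generalizing w' with
  | nil =>
    have : w' = [] := List.eq_nil_iff_forall_not_mem.2 fun a ha => by simpa using (hm a).2 ha
    rw [this]
  | cons x u ih₁ ih₂ =>
    cases w' with
    | nil => exact absurd ((hm x).1 (by simp)) (by simp)
    | cons x' u' =>
      obtain ⟨hx, hu⟩ := List.nodup_cons.1 hw
      obtain ⟨hx', hu'⟩ := List.nodup_cons.1 hw'
      -- If the roots differed, the smaller would reach the larger in the word it heads, but not in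
      -- the word headed by the larger.
      have hxx : x = x' := by
        rcases lt_trichotomy x x' with hlt | rfl | hlt
        · have h₁ : x' ∈ u := (List.mem_cons.1 ((hm x').2 (by simp))).resolve_left (by omega)
          exact absurd ((h x x').1 (rightReach_head.2 ⟨h₁, hlt⟩))
            (not_rightReach_of_lt_head hx' hlt le_rfl)
        · rfl
        · have h₁ : x ∈ u' := (List.mem_cons.1 ((hm x).1 (by simp))).resolve_left (by omega)
          exact absurd ((h x' x).2 (rightReach_head.2 ⟨h₁, hlt⟩))
            (not_rightReach_of_lt_head hx hlt le_rfl)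
      subst hxx
      have hm' : ∀ a, a ∈ u ↔ a ∈ u' := by
        intro a
        by_cases ha : a = x
        · subst ha; simp [hx, hx']
        · simpa [ha] using hm a
      rw [pSymbolLeft_cons, pSymbolLeft_cons,
        ih₁ (w' := u'.filter (· < x)) (hu.filter _) (hu'.filter _) (fun a => by simp [hm'])
          (fun a b => by rw [rightReach_filter_lt, rightReach_filter_lt, h]),
        ih₂ (w' := u'.filter (x ≤ ·)) (hu.filter _) (hu'.filter _) (fun a => by simp [hm'])
          (fun a b => by rw [rightReach_filter_le hx, rightReach_filter_le hx', h])]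

/-! ### The weak order on words -/

/-- `w'` is obtained from `w` by exchanging two adjacent letters `a < b`. -/
def WordCov (w w' : List ℕ) : Prop :=
  ∃ (u v : List ℕ) (a b : ℕ), a < b ∧ w = u ++ a :: b :: v ∧ w' = u ++ b :: a :: v

/-- The weak order on words. -/
def WordLE : List ℕ → List ℕ → Prop := Relation.ReflTransGen WordCov

theorem WordCov.perm {w w' : List ℕ} (h : WordCov w w') : w.Perm w' := by
  obtain ⟨u, v, a, b, -, rfl, rfl⟩ := h
  exact (List.Perm.swap _ _ _).append_left u

theorem WordLE.perm {w w' : List ℕ} (h : WordLE w w') : w.Perm w' := by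
  induction h with
  | refl => rfl
  | tail _ h ih => exact ih.trans h.perm

theorem WordCov.reverse {w w' : List ℕ} (h : WordCov w w') : WordCov w'.reverse w.reverse := by
  obtain ⟨u, v, a, b, hab, rfl, rfl⟩ := h
  exact ⟨v.reverse, u.reverse, a, b, hab, by simp, by simp⟩

theorem WordLE.reverse {w w' : List ℕ} (h : WordLE w w') : WordLE w'.reverse w.reverse := by
  induction h with
  | refl => exact .refl
  | tail _ h ih => exact .head h.reverse ih

theorem WordCov.filter {w w' : List ℕ} (h : WordCov w w') (p : ℕ → Bool) :
    WordLE (w.filter p) (w'.filter p) := by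
  obtain ⟨u, v, a, b, hab, rfl, rfl⟩ := h
  by_cases ha : p a <;> by_cases hb : p b
  · exact .single ⟨u.filter p, v.filter p, a, b, hab, by simp [ha, hb], by simp [ha, hb]⟩
  all_goals
    simp only [List.filter_append, List.filter_cons, ha, hb, if_true]
    exact .refl

theorem WordLE.filter {w w' : List ℕ} (h : WordLE w w') (p : ℕ → Bool) :
    WordLE (w.filter p) (w'.filter p) := by
  induction h with
  | refl => exact .refl
  | tail _ h ih => exact ih.trans (h.filter p)

theorem WordCov.cons {w w' : List ℕ} (h : WordCov w w') (x : ℕ) : WordCov (x :: w) (x :: w') := by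
  obtain ⟨u, v, a, b, hab, rfl, rfl⟩ := h
  exact ⟨x :: u, v, a, b, hab, rfl, rfl⟩

theorem WordLE.cons {w w' : List ℕ} (h : WordLE w w') (x : ℕ) : WordLE (x :: w) (x :: w') :=
  Relation.ReflTransGen.lift (x :: ·) (fun _ _ h => WordCov.cons h x) _ _ h

/-- Going up in the weak order only creates inversions, so a non-inversion above was already one
below. This gives the monotonicity of `RightReach`. -/
theorem WordCov.pair_sublist {w w' : List ℕ} (h : WordCov w w') {x y : ℕ} (hxy : x < y)
    (hs : [x, y].Sublist w') : [x, y].Sublist w := by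
  obtain ⟨u, v, a, b, hab, rfl, rfl⟩ := h
  induction u with
  | nil =>
    simp only [List.nil_append, List.cons_sublist_cons', List.singleton_sublist] at hs ⊢
    grind
  | cons z u ih =>
    simp only [List.cons_append, List.cons_sublist_cons', List.singleton_sublist] at hs ⊢
    rcases hs with hs | ⟨rfl, hs⟩
    · exact .inl (ih hs)
    · refine .inr ⟨rfl, ?_⟩
      simp only [List.mem_append, List.mem_cons] at hs ⊢
      tauto

theorem WordLE.rightReach {w w' : List ℕ} (h : WordLE w w') {a b : ℕ}
    (hr : RightReach w' a b) : RightReach w a b := by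
  induction h with
  | refl => exact hr
  | tail _ h ih =>
    refine ih ?_
    obtain ⟨ha, hb, hab, hr⟩ := hr
    exact ⟨h.perm.mem_iff.2 ha, h.perm.mem_iff.2 hb, hab, fun c hc hac hcb =>
      h.pair_sublist hac (hr c (h.perm.mem_iff.1 hc) hac hcb)⟩

/-- Antisymmetry of the relation induced by the weak order on left binary search trees. -/
theorem pSymbolLeft_eq_of_wordLE {w₁ w₂ w₃ w₄ : List ℕ} (hw : w₁.Nodup) (h₁₂ : WordLE w₁ w₂)
    (h₂₃ : pSymbolLeft w₂ = pSymbolLeft w₃) (hw' : w₃.Nodup) (h₃₄ : WordLE w₃ w₄)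
    (h₄₁ : pSymbolLeft w₄ = pSymbolLeft w₁) : pSymbolLeft w₁ = pSymbolLeft w₂ := by
  have hw₂ := h₁₂.perm.nodup_iff.1 hw
  have hw₄ := h₃₄.perm.nodup_iff.1 hw'
  -- Going round the cycle, `RightReach` shrinks on both weak-order steps and is constant on both
  -- equalities, so it never changes.
  refine pSymbolLeft_eq_of_rightReach_iff hw hw₂ (fun a => h₁₂.perm.mem_iff) fun a b =>
    ⟨fun h => ?_, fun h => h₁₂.rightReach h⟩
  rw [rightReach_iff_of_pSymbolLeft_eq hw₂ hw' h₂₃]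
  refine h₃₄.rightReach ?_
  rwa [rightReach_iff_of_pSymbolLeft_eq hw₄ hw h₄₁]

theorem wordLE_bubble {x : ℕ} {u : List ℕ} (h : ∀ a ∈ u, a < x) (v : List ℕ) :
    WordLE (u ++ x :: v) (x :: (u ++ v)) := by
  induction u with
  | nil => exact .refl
  | cons a u ih =>
    refine .tail ((ih fun c hc => h c (by simp [hc])).cons a) ?_
    exact ⟨[], u ++ v, a, x, h a (by simp), rfl, rfl⟩

theorem wordLE_of_filter_append (c : ℕ) (w : List ℕ) :
    WordLE (w.filter (· < c) ++ w.filter (c ≤ ·)) w := by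
  induction w with
  | nil => exact .refl
  | cons x w ih =>
    by_cases h : x < c
    · have h' : ¬ c ≤ x := by omega
      simpa [h, h'] using ih.cons x
    · have h' : c ≤ x := by omega
      simp only [h, h', decide_true, decide_false, List.filter_cons, if_true, Bool.false_eq_true,
        if_false]
      -- A high first letter `x` moves left past all the low letters, each move being an upward
      -- exchange.
      refine (wordLE_bubble ?_ _).trans (ih.cons x)
      intro a ha
      have := (List.mem_filter.1 ha).2
      simp only [decide_eq_true_eq] at this
      omega

theorem wordLE_filter_append (c : ℕ) (w : List ℕ) :
    WordLE w (w.filter (c ≤ ·) ++ w.filter (· < c)) := by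
  simpa [List.filter_reverse] using (wordLE_of_filter_append c w.reverse).reverse

theorem symLE_iff {n : ℕ} {σ ν : SymWord n} : SymLE σ ν ↔ WordLE σ.1 ν.1 := by
  constructor
  · exact fun h => Relation.ReflTransGen.lift (p := WordCov) Subtype.val (fun _ _ h => h) _ _ h
  · obtain ⟨w', hw'⟩ := ν
    intro h
    change WordLE σ.1 w' at h
    induction h with
    | refl => exact .refl
    | tail _ hc ih => exact .tail (ih (hc.perm.trans hw')) hc

/-! ### Restriction of permutations -/

section
variable {m n : ℕ}

/-- The restriction of a permutation of size `m + n` to its letters at most `m`. -/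
def lowPart (π : SymWord (m + n)) : SymWord m :=
  ⟨π.1.filter (· < 1 + m), filter_lt_perm_range' π.2 m (by omega)⟩

theorem highPart_perm (π : SymWord (m + n)) :
    ((π.1.filter (1 + m ≤ ·)).map (· - m)).Perm (List.range' 1 n) := by
  have h := (filter_le_perm_range' π.2 m (by omega)).map (· - m)
  rwa [List.map_sub_range' (h := by omega), Nat.add_sub_cancel, Nat.add_sub_cancel_left] at h

/-- The standardized restriction of a permutation of size `m + n` to its letters above `m`. -/
def highPart (π : SymWord (m + n)) : SymWord n :=
  ⟨(π.1.filter (1 + m ≤ ·)).map (· - m), highPart_perm π⟩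

theorem map_add_highPart (π : SymWord (m + n)) :
    (highPart π).1.map (· + m) = π.1.filter (1 + m ≤ ·) := by
  rw [highPart, List.map_map]
  conv_rhs => rw [← List.map_id (π.1.filter _)]
  refine List.map_congr_left fun a ha => ?_
  have h := (List.mem_filter.1 ha).2
  simp only [decide_eq_true_eq] at h
  simp only [Function.comp_apply, id_eq]
  omega

theorem leftShape_highPart (π : SymWord (m + n)) :
    leftShape (highPart π).1 = leftShape (π.1.filter (1 + m ≤ ·)) := by
  rw [← map_add_highPart, leftShape_map_add]

theorem leftShape_reverse_highPart (π : SymWord (m + n)) :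
    leftShape (highPart π).1.reverse = leftShape (π.1.reverse.filter (1 + m ≤ ·)) := by
  rw [List.filter_reverse, ← map_add_highPart, ← List.map_reverse, leftShape_map_add]

theorem pSymbol_eq_iff_parts (π : SymWord (m + n)) (J₀ : TBT m) (J₁ : TBT n) :
    pSymbol (lowPart π) = J₀ ∧ pSymbol (highPart π) = J₁ ↔
      (leftShape (π.1.filter (· < 1 + m)) = J₀.left ∧
        leftShape (π.1.filter (1 + m ≤ ·)) = J₁.left) ∧
      (leftShape (π.1.reverse.filter (· < 1 + m)) = J₀.right ∧
        leftShape (π.1.reverse.filter (1 + m ≤ ·)) = J₁.right) := by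
  rw [TBT.ext_iff, TBT.ext_iff, ← leftShape_highPart, ← leftShape_reverse_highPart,
    List.filter_reverse]
  change (leftShape (lowPart π).1 = _ ∧ leftShape (lowPart π).1.reverse = _) ∧
    leftShape (highPart π).1 = _ ∧ leftShape (highPart π).1.reverse = _ ↔ _
  rw [lowPart]
  tauto

/-! ### Intervals of the Baxter order -/

theorem le_iff (J J' : TBT n) :
    J ≤ J' ↔ ∃ σ ν : SymWord n, WordLE σ.1 ν.1 ∧ pSymbol σ = J ∧ pSymbol ν = J' := by
  change (∃ σ ν : SymWord n, SymLE σ ν ∧ HasPSymbol σ J ∧ HasPSymbol ν J') ↔ _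
  simp only [symLE_iff, hasPSymbol_iff]

/-- On a fixed interval of letters shapes determine labels; this passes from unlabeled pairs to
labeled trees, which can be cut at a letter. -/
theorem pSymbolLeft_eq_of_pSymbol_eq {σ ν : SymWord n} (h : pSymbol σ = pSymbol ν) :
    pSymbolLeft σ.1 = pSymbolLeft ν.1 ∧
      pSymbolLeft σ.1.reverse = pSymbolLeft ν.1.reverse :=
  ⟨pSymbolLeft_eq_of_leftShape_eq σ.2 ν.2 (congrArg TBT.left h),
    pSymbolLeft_eq_of_leftShape_eq ((List.reverse_perm _).trans σ.2)
      ((List.reverse_perm _).trans ν.2) (congrArg TBT.right h)⟩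

theorem pSymbol_eq_over {π : SymWord (m + n)} {J₀ : TBT m} {J₁ : TBT n}
    (h₀ : pSymbol (lowPart π) = J₀) (h₁ : pSymbol (highPart π) = J₁) (τ : SymWord (m + n))
    (hτ : τ.1 = π.1.filter (· < 1 + m) ++ π.1.filter (1 + m ≤ ·)) :
    pSymbol τ = J₀.over J₁ := by
  obtain ⟨⟨a, b⟩, c, d⟩ := (pSymbol_eq_iff_parts π J₀ J₁).1 ⟨h₀, h₁⟩
  rw [TBT.ext_iff]
  change leftShape τ.1 = treeUnder _ _ ∧ leftShape τ.1.reverse = treeOver _ _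
  rw [hτ, List.reverse_append, ← List.filter_reverse, ← List.filter_reverse, ← a, ← b, ← c, ← d]
  refine ⟨leftShape_append ?_, leftShape_append_of_gt ?_⟩ <;>
  · intro x hx y hy
    have hx := (List.mem_filter.1 hx).2
    have hy := (List.mem_filter.1 hy).2
    simp only [decide_eq_true_eq] at hx hy
    omega

theorem pSymbol_eq_under {π : SymWord (m + n)} {J₀ : TBT m} {J₁ : TBT n}
    (h₀ : pSymbol (lowPart π) = J₀) (h₁ : pSymbol (highPart π) = J₁) (τ : SymWord (m + n))
    (hτ : τ.1 = π.1.filter (1 + m ≤ ·) ++ π.1.filter (· < 1 + m)) :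
    pSymbol τ = J₀.under J₁ := by
  obtain ⟨⟨a, b⟩, c, d⟩ := (pSymbol_eq_iff_parts π J₀ J₁).1 ⟨h₀, h₁⟩
  rw [TBT.ext_iff]
  change leftShape τ.1 = treeOver _ _ ∧ leftShape τ.1.reverse = treeUnder _ _
  rw [hτ, List.reverse_append, ← List.filter_reverse, ← List.filter_reverse, ← a, ← b, ← c, ← d]
  refine ⟨leftShape_append_of_gt ?_, leftShape_append ?_⟩ <;>
  · intro x hx y hy
    have hx := (List.mem_filter.1 hx).2
    have hy := (List.mem_filter.1 hy).2
    simp only [decide_eq_true_eq] at hx hy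
    omega

/-- The parts of a permutation are squeezed by those of permutations around its class. -/
theorem leftShape_filter_squeeze {w₁ w₂ w₃ w₄ w : List ℕ} {s k : ℕ}
    (h₁ : w₁.Perm (List.range' s k)) (h₃ : w₃.Perm (List.range' s k))
    (h₁₂ : WordLE w₁ w₂) (h₃₄ : WordLE w₃ w₄)
    (e₂ : pSymbolLeft w₂ = pSymbolLeft w) (e₃ : pSymbolLeft w₃ = pSymbolLeft w)
    {A C : BinaryTree Unit} (hA : s + A.numNodes ≤ s + k)
    (e₁ : leftShape w₁ = treeUnder A C ∧ leftShape w₄ = treeOver A C ∨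
      leftShape w₁ = treeOver A C ∧ leftShape w₄ = treeUnder A C) :
    leftShape (w.filter (· < s + A.numNodes)) = A ∧
      leftShape (w.filter (s + A.numNodes ≤ ·)) = C := by
  have h₄ := h₃₄.perm.symm.trans h₃
  have hn₁ := ((perm_range'_iff _ _ _).1 h₁).1
  have hn₃ := ((perm_range'_iff _ _ _).1 h₃).1
  -- Both graftings of `A` and `C` put `A` on the low letters, so the outer words have equal
  -- restricted trees.
  have key : (leftShape (w₁.filter (· < s + A.numNodes)) = A ∧
      leftShape (w₁.filter (s + A.numNodes ≤ ·)) = C) ∧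
      leftShape (w₄.filter (· < s + A.numNodes)) = A ∧
      leftShape (w₄.filter (s + A.numNodes ≤ ·)) = C := by
    rcases e₁ with ⟨a, b⟩ | ⟨a, b⟩
    · exact ⟨leftShape_filter_of_eq_treeUnder h₁ rfl a, leftShape_filter_of_eq_treeOver h₄ rfl b⟩
    · exact ⟨leftShape_filter_of_eq_treeOver h₁ rfl a, leftShape_filter_of_eq_treeUnder h₄ rfl b⟩
  obtain ⟨⟨l₁, r₁⟩, l₄, r₄⟩ := key
  have f₂ := pSymbolLeft_filter_congr e₂ (s + A.numNodes)
  have f₃ := pSymbolLeft_filter_congr e₃ (s + A.numNodes)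
  have g₁ := pSymbolLeft_eq_of_wordLE (hn₁.filter _) (h₁₂.filter _) (f₂.1.trans f₃.1.symm)
    (hn₃.filter _) (h₃₄.filter _)
    (pSymbolLeft_eq_of_leftShape_eq (filter_lt_perm_range' h₄ _ (by omega))
      (filter_lt_perm_range' h₁ _ (by omega)) (l₄.trans l₁.symm))
  have g₂ := pSymbolLeft_eq_of_wordLE (hn₁.filter _) (h₁₂.filter _) (f₂.2.trans f₃.2.symm)
    (hn₃.filter _) (h₃₄.filter _)
    (pSymbolLeft_eq_of_leftShape_eq (filter_le_perm_range' h₄ _ (by omega))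
      (filter_le_perm_range' h₁ _ (by omega)) (r₄.trans r₁.symm))
  exact ⟨(congrArg shape (g₁.trans f₂.1)).symm.trans l₁,
    (congrArg shape (g₂.trans f₂.2)).symm.trans r₁⟩

theorem mem_interval_iff (J₀ : TBT m) (J₁ : TBT n) (π : SymWord (m + n)) :
    J₀.over J₁ ≤ pSymbol π ∧ pSymbol π ≤ J₀.under J₁ ↔
      pSymbol (lowPart π) = J₀ ∧ pSymbol (highPart π) = J₁ := by
  constructor
  · rw [le_iff, le_iff]
    rintro ⟨⟨σ, τ, hστ, hσ, hτ⟩, τ', μ, hτμ, hτ', hμ⟩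
    rw [pSymbol_eq_iff_parts]
    have hl := pSymbolLeft_eq_of_pSymbol_eq hτ
    have hl' := pSymbolLeft_eq_of_pSymbol_eq hτ'
    constructor
    · have := leftShape_filter_squeeze σ.2 τ'.2 hστ hτμ hl.1 hl'.1 (A := J₀.left)
        (C := J₁.left) (by rw [J₀.numNodes_left]; omega)
        (.inl ⟨congrArg TBT.left hσ, congrArg TBT.left hμ⟩)
      rwa [J₀.numNodes_left] at this
    -- Reversal swaps the ends of the chain, and on right trees `under` and `over` swap graftings,
    -- so the same alternative applies.
    · have := leftShape_filter_squeeze ((List.reverse_perm _).trans μ.2)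
        ((List.reverse_perm _).trans τ.2) hτμ.reverse hστ.reverse hl'.2 hl.2 (A := J₀.right)
        (C := J₁.right) (by rw [J₀.numNodes_right]; omega)
        (.inl ⟨congrArg TBT.right hμ, congrArg TBT.right hσ⟩)
      rwa [J₀.numNodes_right] at this
  · rintro ⟨h₀, h₁⟩
    have hl := wordLE_of_filter_append (1 + m) π.1
    have hu := wordLE_filter_append (1 + m) π.1
    rw [le_iff, le_iff]
    exact ⟨⟨⟨_, hl.perm.trans π.2⟩, π, hl, pSymbol_eq_over h₀ h₁ _ rfl, rfl⟩,
      π, ⟨_, hu.perm.symm.trans π.2⟩, hu, rfl, pSymbol_eq_under h₀ h₁ _ rfl⟩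

/-! ### The terms of the shifted shuffle -/

/-- When the alphabets are separated by `c`, filtering at `c` recovers both factors. -/
theorem mem_shuffle_iff {u v : List ℕ} {c : ℕ} (hu : ∀ a ∈ u, a < c) (hv : ∀ b ∈ v, c ≤ b)
    (w : List ℕ) : w ∈ shuffle u v ↔ w.filter (· < c) = u ∧ w.filter (c ≤ ·) = v := by
  fun_induction shuffle u v generalizing w with
  | case1 u =>
    rw [List.mem_singleton]
    constructor
    · rintro rfl
      refine ⟨List.filter_eq_self.2 (by simpa using hu), List.filter_eq_nil_iff.2 (by simpa using hu)⟩
    · rintro ⟨h, h'⟩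
      rw [← h]
      refine (List.filter_eq_self.2 ?_).symm
      simpa [List.filter_eq_nil_iff] using h'
  | case2 b v =>
    rw [List.mem_singleton]
    constructor
    · rintro rfl
      refine ⟨List.filter_eq_nil_iff.2 (by simpa using hv), List.filter_eq_self.2 (by simpa using hv)⟩
    · rintro ⟨h, h'⟩
      rw [← h']
      refine (List.filter_eq_self.2 ?_).symm
      simpa [List.filter_eq_nil_iff] using h
  | case3 a u b v ih1 ih2 =>
    have ha : a < c := hu a (by simp)
    have hb : c ≤ b := hv b (by simp)
    have i1 := ih1 (fun x hx => hu x (by simp [hx])) hv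
    have i2 := ih2 hu (fun x hx => hv x (by simp [hx]))
    rcases w with _ | ⟨x, w⟩
    · simp
    · have : x :: w ∈ (shuffle u (b :: v)).map (a :: ·) ++ (shuffle (a :: u) v).map (b :: ·) ↔
          (x = a ∧ w ∈ shuffle u (b :: v)) ∨ (x = b ∧ w ∈ shuffle (a :: u) v) := by
        simp only [List.mem_append, List.mem_map, List.cons.injEq]
        aesop
      rw [this, i1, i2]
      by_cases hx : x < c
      · have hx' : ¬ c ≤ x := by omega
        have hxb : x ≠ b := by omega
        simp [hx, hx', hxb, and_assoc]
      · have hx' : c ≤ x := by omega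
        have hxa : x ≠ a := by omega
        simp [hx, hx', hxa]
        tauto

theorem nodup_shuffle {u v : List ℕ} {c : ℕ} (hu : ∀ a ∈ u, a < c) (hv : ∀ b ∈ v, c ≤ b) :
    (shuffle u v).Nodup := by
  fun_induction shuffle u v with
  | case1 u => simp
  | case2 b v => simp
  | case3 a u b v ih1 ih2 =>
    have ha : a < c := hu a (by simp)
    have hb : c ≤ b := hv b (by simp)
    refine List.Nodup.append
      ((ih1 (fun x hx => hu x (by simp [hx])) hv).map (List.cons_injective))
      ((ih2 hu (fun x hx => hv x (by simp [hx]))).map (List.cons_injective)) ?_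
    intro w h h'
    obtain ⟨x, -, rfl⟩ := List.mem_map.1 h
    obtain ⟨y, -, hy⟩ := List.mem_map.1 h'
    have := (List.cons.inj hy).1
    omega

theorem SymWord.lt_of_mem (σ : SymWord m) : ∀ a ∈ σ.1, a < 1 + m := fun a ha =>
  ((((perm_range'_iff _ _ _).1 σ.2).2 a).1 ha).2

theorem SymWord.le_of_mem_map_add (ν : SymWord n) (m : ℕ) :
    ∀ b ∈ ν.1.map (· + m), 1 + m ≤ b := by
  intro b hb
  obtain ⟨a, ha, rfl⟩ := List.mem_map.1 hb
  have := ((((perm_range'_iff _ _ _).1 ν.2).2 a).1 ha).1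
  omega

theorem mem_shiftedShuffle_iff (σ : SymWord m) (ν : SymWord n) (π : SymWord (m + n)) :
    π ∈ shiftedShuffle σ ν ↔ lowPart π = σ ∧ highPart π = ν := by
  have h : π ∈ shiftedShuffle σ ν ↔ π.1 ∈ shuffle σ.1 (ν.1.map (· + m)) := by
    constructor
    · intro h
      obtain ⟨w, -, rfl⟩ := List.mem_map.1 h
      exact w.2
    · intro h
      exact List.mem_map.2 ⟨⟨π.1, h⟩, List.mem_attach _ _, rfl⟩
  rw [h, mem_shuffle_iff σ.lt_of_mem (ν.le_of_mem_map_add m), ← map_add_highPart,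
    (List.map_injective_iff.2 (add_left_injective m)).eq_iff]
  exact and_congr (Subtype.ext_iff (a1 := lowPart π)).symm
    (Subtype.ext_iff (a1 := highPart π)).symm

theorem nodup_shiftedShuffle (σ : SymWord m) (ν : SymWord n) : (shiftedShuffle σ ν).Nodup := by
  refine List.Nodup.map (fun w w' h => Subtype.ext (congrArg (fun π : SymWord (m + n) => π.1) h)) ?_
  exact List.nodup_attach.2 (nodup_shuffle σ.lt_of_mem (ν.le_of_mem_map_add m))

end

/-! ### The product of `Baxter` -/

section
variable (K : Type*) [Field K]

open Classical in
theorem F_mul_F_eq_sum {m n : ℕ} (σ : SymWord m) (ν : SymWord n) :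
    F K σ * F K ν = ∑ π : SymWord (m + n) with lowPart π = σ ∧ highPart π = ν, F K π := by
  rw [F_mul_F, ← List.sum_toFinset _ (nodup_shiftedShuffle σ ν)]
  refine Finset.sum_congr (Finset.ext fun π => ?_) fun _ _ => rfl
  simp [mem_shiftedShuffle_iff]

open Classical in
theorem P_eq_sum {n : ℕ} (J : TBT n) : P K J = ∑ σ : SymWord n with pSymbol σ = J, F K σ := by
  simp only [P, hasPSymbol_iff]

theorem sum_mul_sum_fqSym {ι κ : Type*} (s : Finset ι) (t : Finset κ) (f : ι → FQSym K)
    (g : κ → FQSym K) : (∑ i ∈ s, f i) * ∑ j ∈ t, g j = ∑ i ∈ s, ∑ j ∈ t, f i * g j := by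
  change mulBilin K _ _ = ∑ i ∈ s, ∑ j ∈ t, mulBilin K (f i) (g j)
  simp only [map_sum, LinearMap.sum_apply]
  exact Finset.sum_comm

open Classical in
theorem P_mul_P {m n : ℕ} (J₀ : TBT m) (J₁ : TBT n) :
    P K J₀ * P K J₁ = ∑ J : TBT (m + n) with J₀.over J₁ ≤ J ∧ J ≤ J₀.under J₁, P K J := by
  -- Group the permutations of the interval by their P-symbol.
  have hR : ∑ J : TBT (m + n) with J₀.over J₁ ≤ J ∧ J ≤ J₀.under J₁, P K J =
      ∑ π : SymWord (m + n) with J₀.over J₁ ≤ pSymbol π ∧ pSymbol π ≤ J₀.under J₁, F K π := by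
    rw [← Finset.sum_fiberwise_of_maps_to
      (g := pSymbol) (t := {J | J₀.over J₁ ≤ J ∧ J ≤ J₀.under J₁}) (by simp)]
    refine Finset.sum_congr rfl fun J hJ => ?_
    rw [P_eq_sum, Finset.filter_filter]
    refine Finset.sum_congr (Finset.filter_congr fun π _ => ?_) fun _ _ => rfl
    constructor
    · rintro rfl
      exact ⟨by simpa using hJ, rfl⟩
    · exact And.right
  rw [hR, P_eq_sum, P_eq_sum, sum_mul_sum_fqSym]
  simp only [F_mul_F_eq_sum, mem_interval_iff]
  -- Group the same permutations by their pair of restrictions, to match the expanded product term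
  -- by term.
  rw [← Finset.sum_product', ← Finset.sum_fiberwise_of_maps_to
    (g := fun π => (lowPart π, highPart π))
    (t := ({σ | pSymbol σ = J₀} : Finset (SymWord m)) ×ˢ
      ({ν | pSymbol ν = J₁} : Finset (SymWord n))) (by simp)]
  refine Finset.sum_congr rfl fun p hp => ?_
  rw [Finset.filter_filter]
  refine Finset.sum_congr (Finset.filter_congr fun π _ => ?_) fun _ _ => rfl
  rw [Prod.ext_iff]
  constructor
  · rintro ⟨h, h'⟩
    rw [h, h']
    exact ⟨by simpa using hp, rfl, rfl⟩
  · exact And.right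

theorem mul_mem_baxter {x y : FQSym K} (hx : x ∈ Baxter K) (hy : y ∈ Baxter K) :
    x * y ∈ Baxter K := by
  classical
  have h : Submodule.map₂ (mulBilin K) (Baxter K) (Baxter K) ≤ Baxter K := by
    rw [Baxter, Submodule.map₂_span_span, Submodule.span_le]
    rintro _ ⟨_, ⟨⟨m, J₀⟩, rfl⟩, _, ⟨⟨n, J₁⟩, rfl⟩, rfl⟩
    change P K J₀ * P K J₁ ∈ Baxter K
    rw [P_mul_P]
    exact Submodule.sum_mem _ fun J _ => Submodule.subset_span ⟨⟨_, J⟩, rfl⟩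
  exact h (Submodule.apply_mem_map₂ _ hx hy)

end

end BaxterAlg

open BaxterAlg Classical in
theorem mainTheorem9 (K : Type*) [Field K] [CharZero K] :
    (∀ x ∈ Baxter K, ∀ y ∈ Baxter K, x * y ∈ Baxter K) ∧
    ∀ (m n : ℕ) (J₀ : TBT m) (J₁ : TBT n),
      P K J₀ * P K J₁ =
        ∑ J : TBT (m + n) with J₀.over J₁ ≤ J ∧ J ≤ J₀.under J₁, P K J := by
  refine ⟨fun x hx y hy => mul_mem_baxter K hx hy, fun m n J₀ J₁ => ?_⟩
  rw [P_mul_P]
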